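/- Let $q$ be a prime power, and for integers $m\ge 0$, $k\ge 1$ consider the generic polynomial $P=\sum_{s=0}^m a_s\theta^s$ with indeterminate coefficients over $\mathbb F_q$ (put $a_s=0$ for $s\notin[0,m]$) and the $k\times k$ matrix $\mathfrak M(P,k)$ over $\mathbb F_q[a_0,\dots,a_m][T]$ with entries $$\mathfrak M(P,k)_{ij}=a_{iq-j}T-a_{iq-j-1},\qquad 1\le i,j\le k .$$ For $k\ge\frac{m+1}{q-1}$ the $L$-function of the twist by $P$ of the Carlitz module over $\mathbb F_q(\theta)$ is $\det(I_k-\mathfrak M(P,k)U)$, and the order of its zero at $U=1$ is the analytic rank of $P$. Write $$\det\big((W+1)I_k-\mathfrak M(P,k)\big)=\sum_{i=0}^k D_iW^i,\qquad D_i=\sum_{j=0}^{k-i}d_{ij}T^j,\qquad d_{ij}\in\mathbb F_q[a_0,\dots,a_m],$$ so that analytic rank $\ge r$ means $D_0=\dots=D_{r-1}=0$. Let $\bar d_{ij}$ be the homogenization of $d_{ij}$ by one additional variable, and let $$\bar{\mathfrak R}(m,r)=\bar{\mathfrak R}(m,r)_k\subset\mathbb P^{m+1}(\overline{\mathbb F}_q)$$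 be the set of common zeroes of the $\bar d_{ij}$ with $0\le i<r$, $0\le j\le k-i$. Let $r\ge 0$ be an integer. 1. If $r\le 2q-3$, then there exists $m$ such that $\dim\bar{\mathfrak R}(m,r)_k\ge 0$ for all $k\ge\frac{m+1}{q-1}$ (that is, $\bar{\mathfrak R}(m,r)_k$ is not empty). 2. Let $r>2q-3$, let $m\ge 0$ and $k\ge\frac{m+1}{q-1}$. If $\bar{\mathfrak R}(m,r)_k\subset\mathbb P^{m+1}$ is the complete intersection of the $\bar d_{ij}$, $0\le i<r$, $0\le j\le k-i$ (every irreducible component of $\bar{\mathfrak R}(m,r)_k$ has codimension in $\mathbb P^{m+1}$ equal to the number of pairs $(i,j)$ for which $\bar d_{ij}$ is not identically zero), then $\bar{\mathfrak R}(m,r)_k=\emptyset$. -/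

import Mathlib

open MvPolynomial

noncomputable section

namespace CarlitzTwist

/-! ### Projective varieties over a field: zero loci, Zariski topology, dimension -/

section Projective

variable {K σ : Type*} [Field K]

/-- The homogenization of a polynomial `p` in the variables `σ`, with respect to its own total
degree `D`: the sum of `X₀ ^ (D - n) * pₙ`, where `pₙ` is the homogeneous component of `p` of
degree `n`. The new variable `X₀` is the one with index `none`. The homogenization of `0` is `0`. -/
def homogenize {R : Type*} [CommSemiring R] (p : MvPolynomial σ R) :
    MvPolynomial (Option σ) R :=
  ∑ n ∈ Finset.range (p.totalDegree + 1),
    X none ^ (p.totalDegree - n) * rename some (homogeneousComponent n p)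

/-- A polynomial (with coefficients in a subfield `F`) vanishes at a point of the projective
space if it vanishes at every vector of the corresponding line. It is used for homogeneous
polynomials only, and there it is enough to test one non-zero vector of the line. -/
def VanishesAt {F : Type*} [Field F] [Algebra F K] (f : MvPolynomial σ F)
    (x : Projectivization K (σ → K)) : Prop :=
  ∀ v ∈ x.submodule, aeval v f = 0

/-- The Zariski topology on the projective space `ℙ K (σ → K)`: it is generated by the
non-vanishing loci of the homogeneous polynomials. -/
abbrev zariskiTopology (K σ : Type*) [Field K] :
    TopologicalSpace (Projectivization K (σ → K)) :=
  TopologicalSpace.generateFrom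
    {O | ∃ (n : ℕ) (f : MvPolynomial σ K), f.IsHomogeneous n ∧ O = {x | ¬ VanishesAt f x}}

/-- The dimension of a subset of the projective space: the Krull dimension of the subspace
topology that the Zariski topology induces. It is `⊥` for the empty set and is at least `0` for
all other sets. -/
def zariskiDim (V : Set (Projectivization K (σ → K))) : WithBot ℕ∞ :=
  @topologicalKrullDim V ((zariskiTopology K σ).induced Subtype.val)

/-- `Z` is an irreducible component of `V`, i.e. a maximal irreducible subset of `V`. -/
def IsComponentOf (Z V : Set (Projectivization K (σ → K))) : Prop :=
  Maximal (fun Y => @IsIrreducible _ (zariskiTopology K σ) Y ∧ Y ⊆ V) Z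

/-- The common zero locus in the projective space over `K` of a finite family of polynomials. -/
def zeroLocus (K : Type*) [Field K] {F ι : Type*} [Field F] [Algebra F K]
    (s : Finset ι) (f : ι → MvPolynomial σ F) : Set (Projectivization K (σ → K)) :=
  {x | ∀ t ∈ s, VanishesAt (f t) x}

open Classical in
/-- The zero locus, in the projective space over `K` with homogeneous coordinates indexed by `σ`
(which has dimension `#σ - 1`), is the complete intersection of the polynomials `f t`, `t ∈ s`:
each of its irreducible components has codimension equal to the number of equations.
Members of the family that are identically zero do not count as equations. -/
def IsCompleteIntersection (K : Type*) [Field K] [Fintype σ] {F ι : Type*} [Field F] [Algebra F K]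
    (s : Finset ι) (f : ι → MvPolynomial σ F) : Prop :=
  ∀ Z : Set (Projectivization K (σ → K)), IsComponentOf Z (zeroLocus K s f) →
    zariskiDim Z + ((s.filter fun t => f t ≠ 0).card : WithBot ℕ∞) + 1
      = (Fintype.card σ : WithBot ℕ∞)

end Projective

/-! ### The varieties of twists of the Carlitz module -/

section Twists

variable (F : Type*) [Field F] [Fintype F]

/-- The coefficient `a_s` of the generic polynomial `P = a_0 + a_1 θ + ⋯ + a_m θ ^ m`, for any
integer `s`: a variable if `0 ≤ s ≤ m`, and `0` otherwise. -/
def genericCoeff (m : ℕ) (s : ℤ) : MvPolynomial (Fin (m + 1)) F :=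
  if h : 0 ≤ s ∧ s ≤ m then X ⟨s.toNat, by omega⟩ else 0

/-- The `k × k` matrix with entries `a_{iq-j} T - a_{iq-j-1}`, `1 ≤ i, j ≤ k`, where `q = #F`
(rows and columns of the Lean matrix are numbered from `0`). For `k ≥ (m + 1) / (q - 1)` the
`L`-function of the twist of the Carlitz module by `P` is `det (1 - 𝔐 U)`. -/
def frobMatrix (m k : ℕ) :
    Matrix (Fin k) (Fin k) (Polynomial (MvPolynomial (Fin (m + 1)) F)) :=
  Matrix.of fun i j =>
    let s : ℤ := ((i : ℤ) + 1) * (Fintype.card F : ℤ) - ((j : ℤ) + 1)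
    Polynomial.C (genericCoeff F m s) * Polynomial.X - Polynomial.C (genericCoeff F m (s - 1))

/-- The polynomial `D_i` in `T`: the coefficient of `W ^ i` in `det (V - 𝔐)` for `V = W + 1`.
Here `det (V - 𝔐) = V ^ k * det (1 - 𝔐 U)` for `U = V⁻¹`, so the vanishing of `D_0, …, D_{r-1}`
says that `det (1 - 𝔐 U)` has a zero of order at least `r` at `U = 1`. -/
def D (m k i : ℕ) : Polynomial (MvPolynomial (Fin (m + 1)) F) :=
  ((frobMatrix F m k).charpoly.comp (Polynomial.X + 1)).coeff i

/-- The coefficient `d_{ij}` of `T ^ j` in `D_i`, a polynomial in `a_0, …, a_m`. -/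
def d (m k i j : ℕ) : MvPolynomial (Fin (m + 1)) F :=
  (D F m k i).coeff j

/-- The homogenization of `d_{ij}`. -/
def dbar (m k : ℕ) (t : ℕ × ℕ) : MvPolynomial (Option (Fin (m + 1))) F :=
  homogenize (d F m k t.1 t.2)

/-- The indices `(i, j)` of the equations of the locus of analytic rank at least `r`:
`0 ≤ i < r` and `0 ≤ j ≤ k - i` (the degree of `D_i` in `T` is at most `k - i`). -/
def eqIndex (k r : ℕ) : Finset (ℕ × ℕ) :=
  (Finset.range r ×ˢ Finset.range (k + 1)).filter fun t => t.1 + t.2 ≤ k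

/-- The projectivization, in the projective space of dimension `m + 1` over the algebraic closure
of `F`, of the variety of polynomials `P` of degree at most `m` and analytic rank at least `r`,
computed with the matrix of size `k`. -/
def Rbar (m k r : ℕ) :
    Set (Projectivization (AlgebraicClosure F) (Option (Fin (m + 1)) → AlgebraicClosure F)) :=
  zeroLocus (AlgebraicClosure F) (eqIndex k r) (dbar F m k)

end Twists

end CarlitzTwist

end

/-!
Write `q = #F`, and let `c_n` be the coefficient of `V ^ (k - n)` in the characteristic polynomial
of `𝔐(P, k)`. The coefficients `c_{n,j}` of `c_n` in `T` are forms of degree `n` in the `a_s`, and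
`d_{ij} = ∑ n, binom (k - n) i * c_{n,j}`, so this is the decomposition of `d_{ij}` into its
homogeneous components. If `P` has degree less than `l (q - 1)`, then the `l`-th row of `𝔐(P, l)` is
concentrated on the diagonal, with entry `-a_{l (q - 1) - 1}`. Hence enlarging the matrix multiplies
the characteristic polynomial by a known linear factor (`twistMatrix_charpoly_succ`), only the `c_n`
with `n (q - 1) ≤ m + 1` can be nonzero, and for those `n` each `c_{n,j}` with `j < n` is indeed
nonzero (`twistMatrix_charpoly_coeff_ne_zero`).

*Nonemptiness.* Let `l = 2q - 3` and `m + 1 = l (q - 1)`. Requiring that the leading coefficient of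
`P` is `-x₀` and that the characteristic polynomial of `𝔐(P, l - 1)` is `(V - x₀) ^ (l - 1)` takes
`l (l + 1) / 2 = m + 1` homogeneous equations in the `m + 2` unknowns `x₀, a_0, …, a_m`, so there is
a nontrivial solution (`exists_ne_zero_forall_aeval_eq_zero`, from Krull's height theorem and the
Nullstellensatz). At a solution the characteristic polynomial of `𝔐(P, k)` is
`V ^ (k - l) * (V - x₀) ^ l`. After the homogenization this makes all equations with `i < l` vanish,
whether or not `x₀ = 0` (`aeval_dbar_eq_zero`). The points with `x₀ = 0` need care: there only the
top homogeneous component of `d_{ij}` counts, and it matters that the `c_{n,0}` are nonzero.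

*Emptiness.* Let `l` be the integer part of `(m + 1) / (q - 1)`. If the locus is not empty, then no
`d_{i0}` is a nonzero constant, and Pascal's rule shows that for each `i < r` there is an `n` in
`[1, l]` with `binom (k - n) i ≠ 0` in `F` (`exists_choose_ne_zero`). Let `ν i` be the largest one.
By Pascal's rule again, `ν` is a sawtooth function: it starts at `l`, descends by steps of one, and
jumps only up to `l`. So its average is at least `(l + 1) / 2` (`sawtooth_sum`). As `d_{ij} ≠ 0` for
`j < ν i`, there are at least `r (l + 1) / 2 ≥ (q - 1) (l + 1) > m + 1` nonzero equations in
`ℙ ^ (m + 1)`, too many for a nonempty complete intersection.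
-/

noncomputable section

namespace CarlitzTwist

/-! ### Zero loci: dimension, components, and a projective dimension theorem -/

section Geometry

variable {K σ : Type*} [Field K]

lemma zariskiDim_nonneg {V : Set (Projectivization K (σ → K))} (hV : V.Nonempty) :
    0 ≤ zariskiDim V := by
  obtain ⟨x, hx⟩ := hV
  let _ := (zariskiTopology K σ).induced (Subtype.val : V → _)
  exact Order.krullDim_nonneg_iff.2
    ⟨⟨closure {⟨x, hx⟩}, isIrreducible_singleton.closure, isClosed_closure⟩⟩

lemma exists_isComponentOf {V : Set (Projectivization K (σ → K))} (hV : V.Nonempty) :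
    ∃ Z, Z.Nonempty ∧ IsComponentOf Z V := by
  obtain ⟨x, hx⟩ := hV
  let _ := zariskiTopology K σ
  obtain ⟨Z, hxZ, hZ⟩ := zorn_subset_nonempty
    {t : Set (Projectivization K (σ → K)) | IsPreirreducible t ∧ t ⊆ V}
    (fun c hc hcc _ => ⟨⋃₀ c, ⟨fun u v hu hv ⟨y, hy, hyu⟩ ⟨z, hz, hzv⟩ => by
        obtain ⟨p, hpc, hyp⟩ := hy
        obtain ⟨s, hsc, hzs⟩ := hz
        rcases hcc.total hpc hsc with h | h
        · obtain ⟨w, hw, hwuv⟩ := (hc hsc).1 u v hu hv ⟨y, h hyp, hyu⟩ ⟨z, hzs, hzv⟩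
          exact ⟨w, ⟨s, hsc, hw⟩, hwuv⟩
        · obtain ⟨w, hw, hwuv⟩ := (hc hpc).1 u v hu hv ⟨y, hyp, hyu⟩ ⟨z, h hzs, hzv⟩
          exact ⟨w, ⟨p, hpc, hw⟩, hwuv⟩,
      Set.sUnion_subset fun t ht => (hc ht).2⟩, fun _ => Set.subset_sUnion_of_mem⟩)
    {x} ⟨isPreirreducible_singleton, by simpa using hx⟩
  have hxZ' : x ∈ Z := hxZ rfl
  refine ⟨Z, ⟨x, hxZ'⟩, ⟨⟨⟨x, hxZ'⟩, hZ.prop.1⟩, hZ.prop.2⟩, fun Y hY hZY => ?_⟩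
  exact hZ.le_of_ge ⟨hY.1.2, hY.2⟩ hZY

open Classical in
/-- A nonempty complete intersection is cut out by at most `dim ℙ = #σ - 1` nonzero equations. -/
lemma IsCompleteIntersection.card_lt [Fintype σ] {F ι : Type*} [Field F] [Algebra F K]
    {s : Finset ι} {f : ι → MvPolynomial σ F} (h : IsCompleteIntersection K s f)
    (hne : (zeroLocus K s f).Nonempty) :
    (s.filter fun t => f t ≠ 0).card < Fintype.card σ := by
  obtain ⟨Z, hZne, hZ⟩ := exists_isComponentOf hne
  have h1 := h Z hZ
  have h2 := zariskiDim_nonneg hZne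
  have h3 : ((s.filter fun t => f t ≠ 0).card : WithBot ℕ∞) + 1
      ≤ (Fintype.card σ : WithBot ℕ∞) := by
    rw [← h1, add_assoc]
    exact le_add_of_nonneg_left h2
  exact_mod_cast h3

lemma aeval_smul_of_isHomogeneous {F : Type*} [Field F] [Algebra F K] {f : MvPolynomial σ F}
    {n : ℕ} (hf : f.IsHomogeneous n) (t : K) (v : σ → K) :
    aeval (t • v) f = t ^ n * aeval v f := by
  rw [aeval_def, aeval_def, eval₂_eq, eval₂_eq, Finset.mul_sum]
  refine Finset.sum_congr rfl fun u hu => ?_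
  have h1 : ∑ i ∈ u.support, u i = n := by
    simpa [Finsupp.weight_apply, Finsupp.sum] using hf (mem_support_iff.1 hu)
  simp only [Pi.smul_apply, smul_eq_mul, mul_pow, Finset.prod_mul_distrib]
  rw [Finset.prod_pow_eq_pow_sum, h1]
  ring

/-- The ideal of the origin of affine space has height at least the number of coordinates: the
coordinate subspaces give a chain of primes. -/
lemma card_le_height_vanishingIdeal_zero [Fintype σ] :
    (Fintype.card σ : ℕ∞) ≤ (vanishingIdeal K {(0 : σ → K)}).height := by
  classical
  let φ (S : Finset σ) : MvPolynomial σ K →ₐ[K] MvPolynomial σ K :=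
    aeval fun i => if i ∈ S then 0 else X i
  have key : ∀ S : Finset σ, (S.card : ℕ∞) ≤ (RingHom.ker (φ S)).height := by
    intro S
    induction S using Finset.induction_on with
    | empty => simp
    | insert a S ha ih =>
      have : (RingHom.ker (φ S)).IsPrime := RingHom.ker_isPrime _
      have : (RingHom.ker (φ (insert a S))).IsPrime := RingHom.ker_isPrime _
      have hcomp : φ (insert a S) = (φ (insert a S)).comp (φ S) := by
        ext i : 1
        by_cases hi : i ∈ S <;> simp [φ, hi]
      have hlt : RingHom.ker (φ S) < RingHom.ker (φ (insert a S)) := by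
        refine lt_of_le_of_ne (fun p hp => ?_) fun h => ?_
        · rw [RingHom.mem_ker] at hp ⊢
          rw [hcomp, AlgHom.comp_apply, hp, map_zero]
        · have : (X a : MvPolynomial σ K) ∈ RingHom.ker (φ S) := by
            rw [h, RingHom.mem_ker]; simp [φ]
          simp [φ, ha, RingHom.mem_ker] at this
      rw [Finset.card_insert_of_notMem ha]
      have := Ideal.height_strict_mono_of_isPrime_of_isPrime hlt
      push_cast
      exact Order.add_one_le_of_lt (ih.trans_lt this)
  refine (key Finset.univ).trans (Ideal.height_mono fun p hp => ?_)
  rw [mem_vanishingIdeal_singleton_iff]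
  have h0 : (aeval (0 : σ → K) : MvPolynomial σ K →ₐ[K] K)
      = (aeval (0 : σ → K)).comp (φ Finset.univ) := by
    ext i; simp [φ]
  rw [h0, AlgHom.comp_apply, (RingHom.mem_ker).1 hp, map_zero]

/-- Over an algebraically closed field, fewer forms of positive degree than variables have a
common nontrivial zero. Otherwise, by the Nullstellensatz, the ideal of the origin would be a
minimal prime over the ideal they generate, against Krull's height theorem. -/
theorem exists_ne_zero_forall_aeval_eq_zero [IsAlgClosed K] [Fintype σ] {ι : Type*} [Fintype ι]
    (hcard : Fintype.card ι < Fintype.card σ) (f : ι → MvPolynomial σ K) (n : ι → ℕ)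
    (hn : ∀ t, 0 < n t) (hf : ∀ t, (f t).IsHomogeneous (n t)) :
    ∃ v : σ → K, v ≠ 0 ∧ ∀ t, aeval v (f t) = 0 := by
  classical
  by_contra! hcon
  let I : Ideal (MvPolynomial σ K) := Ideal.span (Set.range f)
  have hzero : MvPolynomial.zeroLocus K I = {0} := by
    rw [zeroLocus_span]
    ext v
    simp only [Set.mem_ofPred_eq, Set.forall_mem_range, Set.mem_singleton_iff]
    refine ⟨fun h => by_contra fun hv => ?_, ?_⟩
    · obtain ⟨t, ht⟩ := hcon v hv
      exact ht (h t)
    · rintro rfl t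
      have := aeval_smul_of_isHomogeneous (hf t) (0 : K) (0 : σ → K)
      rwa [zero_smul, zero_pow (hn t).ne', zero_mul] at this
  have hrad : I.radical = vanishingIdeal K {(0 : σ → K)} := by
    rw [← vanishingIdeal_zeroLocus_eq_radical (K := K), hzero]
  have hmin : vanishingIdeal K {(0 : σ → K)} ∈ I.minimalPrimes := by
    refine ⟨⟨inferInstance, hrad ▸ Ideal.le_radical⟩, fun J hJ _ => ?_⟩
    rw [← hrad]
    exact hJ.1.radical_le_iff.2 hJ.2
  have h1 : (vanishingIdeal K {(0 : σ → K)}).height ≤ ((Finset.univ.image f).card : ℕ∞) :=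
    Ideal.height_le_card_of_mem_minimalPrimes_span_finset (by simpa [I] using hmin)
  have h2 := (card_le_height_vanishingIdeal_zero (K := K) (σ := σ)).trans h1
  have h3 : Fintype.card σ ≤ (Finset.univ.image f).card := by exact_mod_cast h2
  exact absurd (h3.trans Finset.card_image_le) (by simpa using hcard)

lemma homogenize_C {R : Type*} [CommSemiring R] (c : R) :
    homogenize (C c : MvPolynomial σ R) = C c := by
  simp [homogenize, homogeneousComponent_zero]

lemma aeval_homogenize {F : Type*} [Field F] [Algebra F K] (p : MvPolynomial σ F)
    (v : Option σ → K) :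
    aeval v (homogenize p) = ∑ n ∈ Finset.range (p.totalDegree + 1),
      v none ^ (p.totalDegree - n) * aeval (fun i => v (some i)) (homogeneousComponent n p) := by
  simp only [homogenize, map_sum, map_mul, map_pow, aeval_X, aeval_rename]
  rfl

lemma homogenize_ne_zero {F : Type*} [Field F] {p : MvPolynomial σ F} (hp : p ≠ 0) :
    homogenize p ≠ 0 := by
  intro h
  -- setting the new variable equal to `1` recovers `p`
  have h1 : aeval (fun i : Option σ => i.elim (1 : MvPolynomial σ F) X) (homogenize p) = p := by
    simp only [homogenize, map_sum, map_mul, map_pow, aeval_X, aeval_rename, Option.elim_none,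
      one_pow, one_mul, Function.comp_def, Option.elim_some, aeval_X_left_apply]
    exact sum_homogeneousComponent p
  rw [h, map_zero] at h1
  exact hp h1.symm

end Geometry

/-! ### The twist matrix with coefficients in an arbitrary ring -/

section TwistMatrix

variable {R S : Type*} [CommRing R] [CommRing S]

/-- The matrix `𝔐(P, k)` for an arbitrary coefficient sequence `a : ℤ → R` and an arbitrary
integer `q`. -/
def twistMatrix (q : ℕ) (a : ℤ → R) (k : ℕ) : Matrix (Fin k) (Fin k) (Polynomial R) :=
  Matrix.of fun i j =>
    let s : ℤ := ((i : ℤ) + 1) * (q : ℤ) - ((j : ℤ) + 1)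
    Polynomial.C (a s) * Polynomial.X - Polynomial.C (a (s - 1))

lemma frobMatrix_eq_twistMatrix (F : Type*) [Field F] [Fintype F] (m k : ℕ) :
    frobMatrix F m k = twistMatrix (Fintype.card F) (genericCoeff F m) k := rfl

lemma twistMatrix_map (f : R →+* S) (q : ℕ) (a : ℤ → R) (k : ℕ) :
    (Polynomial.mapRingHom f).mapMatrix (twistMatrix q a k)
      = twistMatrix q (fun s => f (a s)) k := by
  ext1 i j
  simp [twistMatrix]

lemma twistMatrix_charpoly_coeff_map (f : R →+* S) (q : ℕ) (a : ℤ → R) (k n : ℕ) :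
    ((twistMatrix q a k).charpoly.coeff n).map f
      = (twistMatrix q (fun s => f (a s)) k).charpoly.coeff n := by
  rw [← twistMatrix_map, RingHom.mapMatrix_apply, Matrix.charpoly_map, Polynomial.coeff_map,
    Polynomial.coe_mapRingHom]

lemma det_of_last_row_eq_zero {k : ℕ} (M : Matrix (Fin (k + 1)) (Fin (k + 1)) R)
    (h : ∀ j : Fin k, M (Fin.last k) j.castSucc = 0) :
    M.det = M (Fin.last k) (Fin.last k) * (M.submatrix Fin.castSucc Fin.castSucc).det := by
  rw [Matrix.det_succ_row M (Fin.last k), Fin.sum_univ_castSucc]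
  simp [h, Fin.succAbove_last, ← two_mul, pow_mul]

lemma charpoly_of_last_row_eq_zero {k : ℕ} (M : Matrix (Fin (k + 1)) (Fin (k + 1)) R)
    (h : ∀ j : Fin k, M (Fin.last k) j.castSucc = 0) :
    M.charpoly = (Polynomial.X - Polynomial.C (M (Fin.last k) (Fin.last k)))
      * (M.submatrix Fin.castSucc Fin.castSucc).charpoly := by
  have hsub : M.charmatrix.submatrix Fin.castSucc Fin.castSucc
      = (M.submatrix Fin.castSucc Fin.castSucc).charmatrix := by
    ext1 i j
    simp [Matrix.charmatrix_apply, Matrix.diagonal_apply]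
  rw [Matrix.charpoly, det_of_last_row_eq_zero, hsub, Matrix.charmatrix_apply_eq, Matrix.charpoly]
  intro j
  rw [Matrix.charmatrix_apply_ne _ _ _ (Fin.castSucc_lt_last j).ne', h, map_zero, neg_zero]

lemma twistMatrix_submatrix (q : ℕ) (a : ℤ → R) (k : ℕ) :
    (twistMatrix q a (k + 1)).submatrix Fin.castSucc Fin.castSucc = twistMatrix q a k := by
  ext1 i j
  simp [twistMatrix]

lemma twistMatrix_last_row {q : ℕ} {a : ℤ → R} {k : ℕ}
    (ha : ∀ s : ℤ, (k + 1) * ((q : ℤ) - 1) ≤ s → a s = 0) (j : Fin k) :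
    twistMatrix q a (k + 1) (Fin.last k) j.castSucc = 0 := by
  have hj : (j : ℤ) + 1 ≤ k := by exact_mod_cast j.2
  simp only [twistMatrix, Matrix.of_apply, Fin.val_last, Fin.val_castSucc]
  rw [ha _ (by linarith), ha _ (by linarith)]
  simp

lemma twistMatrix_last_last {q : ℕ} {a : ℤ → R} {k : ℕ}
    (ha : ∀ s : ℤ, (k + 1) * ((q : ℤ) - 1) ≤ s → a s = 0) :
    twistMatrix q a (k + 1) (Fin.last k) (Fin.last k)
      = -Polynomial.C (a ((k + 1) * ((q : ℤ) - 1) - 1)) := by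
  simp only [twistMatrix, Matrix.of_apply, Fin.val_last]
  rw [ha _ (by linarith), map_zero, zero_mul, zero_sub]
  ring_nf

/-- If `deg P < (k + 1) (q - 1)`, then the last row of `𝔐(P, k + 1)` vanishes off the diagonal. -/
lemma twistMatrix_charpoly_succ {q : ℕ} {a : ℤ → R} {k : ℕ}
    (ha : ∀ s : ℤ, (k + 1) * ((q : ℤ) - 1) ≤ s → a s = 0) :
    (twistMatrix q a (k + 1)).charpoly
      = (Polynomial.X + Polynomial.C (Polynomial.C (a ((k + 1) * ((q : ℤ) - 1) - 1))))
        * (twistMatrix q a k).charpoly := by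
  rw [charpoly_of_last_row_eq_zero _ (twistMatrix_last_row ha), twistMatrix_submatrix,
    twistMatrix_last_last ha, map_neg, sub_neg_eq_add]

lemma twistMatrix_det_succ {q : ℕ} {a : ℤ → R} {k : ℕ}
    (ha : ∀ s : ℤ, (k + 1) * ((q : ℤ) - 1) ≤ s → a s = 0) :
    (twistMatrix q a (k + 1)).det
      = -Polynomial.C (a ((k + 1) * ((q : ℤ) - 1) - 1)) * (twistMatrix q a k).det := by
  rw [det_of_last_row_eq_zero _ (twistMatrix_last_row ha), twistMatrix_submatrix,
    twistMatrix_last_last ha]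

/-- Up to a power of the variable, the characteristic polynomial does not depend on the size of
the matrix once the size is large enough. -/
lemma twistMatrix_charpoly_stable {q : ℕ} (hq : 2 ≤ q) {a : ℤ → R} {l k : ℕ} (hlk : l ≤ k)
    (ha : ∀ s : ℤ, (l + 1) * ((q : ℤ) - 1) ≤ s + 1 → a s = 0) :
    (twistMatrix q a k).charpoly = Polynomial.X ^ (k - l) * (twistMatrix q a l).charpoly := by
  induction k, hlk using Nat.le_induction with
  | base => simp
  | succ k hlk ih =>
    have hq' : (1 : ℤ) ≤ (q : ℤ) - 1 := by
      have : (2 : ℤ) ≤ q := by exact_mod_cast hq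
      linarith
    have hlk' : (l : ℤ) ≤ k := by exact_mod_cast hlk
    have hle : (l + 1) * ((q : ℤ) - 1) ≤ (k + 1) * ((q : ℤ) - 1) := by nlinarith
    rw [twistMatrix_charpoly_succ fun s hs => ha s (by linarith), ha _ (by linarith), ih,
      Nat.sub_add_comm hlk, pow_succ]
    simp only [map_zero, add_zero]
    ring

/-- The coefficient of `T ^ k` in `det 𝔐(P, k)` is the determinant of the part of `𝔐(P, k)` that
is linear in `T`. -/
lemma twistMatrix_det_coeff_self (q : ℕ) (a : ℤ → R) (k : ℕ) :
    (twistMatrix q a k).det.coeff k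
      = (Matrix.of fun i j : Fin k => a (((i : ℤ) + 1) * q - (j + 1))).det := by
  have h := Polynomial.coeff_det_X_add_C_card
    (Matrix.of fun i j : Fin k => a (((i : ℤ) + 1) * q - (j + 1)))
    (Matrix.of fun i j : Fin k => -a (((i : ℤ) + 1) * q - (j + 1) - 1))
  rw [Fintype.card_fin] at h
  rw [← h]
  congr 2
  ext1 i j
  simp only [twistMatrix, Matrix.of_apply, Matrix.add_apply, Matrix.smul_apply, Matrix.map_apply,
    smul_eq_mul, map_neg]
  rw [sub_eq_add_neg, Polynomial.X_mul_C]

end TwistMatrix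

/-! ### Homogeneity in the coefficients of `P` -/

section Homogeneity

variable {F σ : Type*} [Field F]

/-- A polynomial in `T` of degree at most `n` all of whose coefficients are forms of degree `n`. -/
def IsForm (n : ℕ) (p : Polynomial (MvPolynomial σ F)) : Prop :=
  p.natDegree ≤ n ∧ ∀ j, (p.coeff j).IsHomogeneous n

lemma IsForm.mul {n n' : ℕ} {p p' : Polynomial (MvPolynomial σ F)} (h : IsForm n p)
    (h' : IsForm n' p') : IsForm (n + n') (p * p') := by
  refine ⟨Polynomial.natDegree_mul_le.trans (add_le_add h.1 h'.1), fun j => ?_⟩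
  rw [Polynomial.coeff_mul]
  exact IsHomogeneous.sum _ _ _ fun x _ => (h.2 _).mul (h'.2 _)

lemma IsForm.sum {ι : Type*} {n : ℕ} (s : Finset ι) (p : ι → Polynomial (MvPolynomial σ F))
    (h : ∀ i ∈ s, IsForm n (p i)) : IsForm n (∑ i ∈ s, p i) := by
  refine ⟨Polynomial.natDegree_sum_le_of_forall_le _ _ fun i hi => (h i hi).1, fun j => ?_⟩
  rw [Polynomial.finsetSum_coeff]
  exact IsHomogeneous.sum _ _ _ fun i hi => (h i hi).2 j

lemma isForm_C_C (c : F) : IsForm 0 (Polynomial.C (C c) : Polynomial (MvPolynomial σ F)) := by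
  refine ⟨by simp, fun j => ?_⟩
  rw [Polynomial.coeff_C]
  split_ifs
  exacts [isHomogeneous_C _ _, isHomogeneous_zero _ _ _]

lemma IsForm.pow {n : ℕ} {p : Polynomial (MvPolynomial σ F)} (h : IsForm n p) (u : ℕ) :
    IsForm (n * u) (p ^ u) := by
  induction u with
  | zero => simpa using isForm_C_C (σ := σ) (1 : F)
  | succ u ih => rw [pow_succ, mul_add, mul_one]; exact ih.mul h

lemma IsForm.prod {ι : Type*} (s : Finset ι) (n : ι → ℕ) (p : ι → Polynomial (MvPolynomial σ F))
    (h : ∀ i ∈ s, IsForm (n i) (p i)) : IsForm (∑ i ∈ s, n i) (∏ i ∈ s, p i) := by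
  classical
  induction s using Finset.induction_on with
  | empty => simpa using isForm_C_C (σ := σ) (1 : F)
  | insert a s ha ih =>
    rw [Finset.sum_insert ha, Finset.prod_insert ha]
    exact (h a (by simp)).mul (ih fun i hi => h i (by simp [hi]))

lemma IsForm.eval₂Hom {τ : Type*} {n : ℕ} {f : MvPolynomial τ F} (hf : f.IsHomogeneous n)
    (g : τ → Polynomial (MvPolynomial σ F)) (hg : ∀ i, IsForm 1 (g i)) :
    IsForm n (eval₂Hom (Polynomial.C.comp C) g f) := by
  rw [coe_eval₂Hom, eval₂_eq]
  refine IsForm.sum _ _ fun u hu => ?_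
  have h1 : ∑ i ∈ u.support, u i = n := by
    simpa [Finsupp.weight_apply, Finsupp.sum] using hf (mem_support_iff.1 hu)
  have h2 := (isForm_C_C (σ := σ) (coeff u f)).mul
    (IsForm.prod u.support (fun i => 1 * u i) (fun i => g i ^ u i) fun i _ => (hg i).pow _)
  simpa [h1] using h2

lemma isForm_charpoly_coeff {k : ℕ} (M : Matrix (Fin k) (Fin k) (Polynomial (MvPolynomial σ F)))
    (hM : ∀ i j, IsForm 1 (M i j)) {n : ℕ} (hn : n ≤ k) : IsForm n (M.charpoly.coeff (k - n)) := by
  have h := Matrix.charpoly.univ_coeff_eval₂Hom (R := F) (Fin k) (Polynomial.C.comp C)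
    (fun x : Fin k × Fin k => M x.1 x.2) (k - n)
  have hM' : (Matrix.of (Function.curry fun x : Fin k × Fin k => M x.1 x.2)) = M := rfl
  rw [hM'] at h
  rw [← h]
  exact IsForm.eval₂Hom
    (Matrix.charpoly.univ_coeff_isHomogeneous F (Fin k) (k - n) n (by simp [hn])) _
    fun x => hM x.1 x.2

lemma isForm_twistMatrix {q : ℕ} {a : ℤ → MvPolynomial σ F} (ha : ∀ s, (a s).IsHomogeneous 1)
    {k : ℕ} (i j : Fin k) : IsForm 1 (twistMatrix q a k i j) := by
  have h : ∀ f g : MvPolynomial σ F, f.IsHomogeneous 1 → g.IsHomogeneous 1 →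
      IsForm 1 (Polynomial.C f * Polynomial.X - Polynomial.C g) := by
    intro f g hf hg
    refine ⟨by compute_degree, fun j => ?_⟩
    rw [Polynomial.coeff_sub]
    refine IsHomogeneous.sub ?_ ?_
    · rcases j with _ | j
      · simp [isHomogeneous_zero]
      · rw [Polynomial.coeff_C_mul, Polynomial.coeff_X]
        split_ifs <;> simp [hf, isHomogeneous_zero]
    · rw [Polynomial.coeff_C]
      split_ifs
      exacts [hg, isHomogeneous_zero _ _ _]
  exact h _ _ (ha _) (ha _)

lemma genericCoeff_isHomogeneous (F : Type*) [Field F] (m : ℕ) (s : ℤ) :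
    (genericCoeff F m s).IsHomogeneous 1 := by
  unfold genericCoeff
  split_ifs
  exacts [isHomogeneous_X _ _, isHomogeneous_zero _ _ _]

lemma genericCoeff_eq_zero (F : Type*) [Field F] {m : ℕ} {s : ℤ} (hs : (m : ℤ) + 1 ≤ s) :
    genericCoeff F m s = 0 := by
  rw [genericCoeff, dif_neg]
  omega

end Homogeneity

/-! ### The generic coefficients of the characteristic polynomial do not vanish -/

section Nonvanishing

variable (F : Type*) [Field F]

/-- The coefficient sequence of a generic polynomial `P` of degree `< t`, over the polynomial
ring in infinitely many variables, where all degrees can be compared. -/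
def truncCoeff (t : ℕ) (s : ℤ) : MvPolynomial ℕ F :=
  if 0 ≤ s ∧ s < t then X s.toNat else 0

lemma truncCoeff_eq_zero {t : ℕ} {s : ℤ} (hs : (t : ℤ) ≤ s) : truncCoeff F t s = 0 := by
  rw [truncCoeff, if_neg]
  omega

lemma truncCoeff_natCast {t s : ℕ} (hs : s < t) : truncCoeff F t s = X s := by
  rw [truncCoeff, if_pos (by omega), Int.toNat_natCast]

/-- Setting the coefficients of degree at least `t` equal to zero. -/
def truncate (t : ℕ) : MvPolynomial ℕ F →ₐ[F] MvPolynomial ℕ F :=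
  aeval fun s => if s < t then X s else 0

lemma truncate_truncCoeff {t t' : ℕ} (h : t ≤ t') (s : ℤ) :
    truncate F t (truncCoeff F t' s) = truncCoeff F t s := by
  unfold truncCoeff truncate
  by_cases h1 : 0 ≤ s ∧ s < t
  · rw [if_pos h1, if_pos (by omega), aeval_X, if_pos (by omega)]
  · rw [if_neg h1]
    split_ifs
    · rw [aeval_X, if_neg (by omega)]
    · simp

/-- The same specialization, on the ring of the generic coefficients of degree at most `m`. -/
def truncateFin (m t : ℕ) : MvPolynomial (Fin (m + 1)) F →ₐ[F] MvPolynomial ℕ F :=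
  aeval fun s => if (s : ℕ) < t then X (s : ℕ) else 0

lemma truncateFin_genericCoeff {m t : ℕ} (h : t ≤ m + 1) (s : ℤ) :
    truncateFin F m t (genericCoeff F m s) = truncCoeff F t s := by
  unfold truncCoeff truncateFin genericCoeff
  by_cases h1 : 0 ≤ s ∧ s < t
  · rw [if_pos h1, dif_pos (by omega), aeval_X, if_pos (by simp; omega)]
  · rw [if_neg h1]
    split_ifs
    · rw [aeval_X, if_neg (by simp; omega)]
    · simp

lemma det_linearPart_ne_zero {q : ℕ} (hq : 2 ≤ q) (l t : ℕ) (ht : l * (q - 1) < t) :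
    (Matrix.of fun i j : Fin l => truncCoeff F t (((i : ℤ) + 1) * q - (j + 1))).det ≠ 0 := by
  obtain ⟨e, rfl⟩ : ∃ e, q = e + 1 := ⟨q - 1, by omega⟩
  rw [Nat.add_sub_cancel] at ht
  induction l generalizing t with
  | zero => simp
  | succ l ih =>
    intro h0
    -- keep only the coefficients of degree at most `(l + 1) (q - 1)`
    have h1 := congrArg (truncate F ((l + 1) * e + 1)) h0
    rw [AlgHom.map_det, map_zero] at h1
    have h2 : (truncate F ((l + 1) * e + 1)).mapMatrix (Matrix.of fun i j : Fin (l + 1) =>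
        truncCoeff F t (((i : ℤ) + 1) * (e + 1 : ℕ) - (j + 1)))
        = Matrix.of fun i j : Fin (l + 1) =>
          truncCoeff F ((l + 1) * e + 1) (((i : ℤ) + 1) * (e + 1 : ℕ) - (j + 1)) := by
      ext1 i j
      exact truncate_truncCoeff F ht _
    rw [h2, det_of_last_row_eq_zero] at h1
    · rcases mul_eq_zero.1 h1 with h3 | h3
      · have : (((Fin.last l : Fin (l + 1)) : ℤ) + 1) * (e + 1 : ℕ)
            - ((Fin.last l : Fin (l + 1)) + 1) = (((l + 1) * e : ℕ) : ℤ) := by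
          simp only [Fin.val_last]; push_cast; ring
        rw [Matrix.of_apply, this, truncCoeff_natCast F (Nat.lt_succ_self _)] at h3
        exact X_ne_zero _ h3
      · exact ih ((l + 1) * e + 1) (by nlinarith) h3
    · intro j
      have hj : (j : ℤ) + 1 ≤ l := by exact_mod_cast j.2
      refine truncCoeff_eq_zero F ?_
      simp only [Fin.val_last, Fin.val_castSucc]
      push_cast
      linarith

/-- All the coefficients in `T` of `det 𝔐(P, l)` are nonzero, for `P` generic of degree at least
`l (q - 1)`. For the lower coefficients one specializes to `deg P = l (q - 1) - 1`, where the last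
row is concentrated on the diagonal. -/
lemma twistMatrix_det_coeff_ne_zero {q : ℕ} (hq : 2 ≤ q) (l t j : ℕ) (ht : l * (q - 1) < t)
    (hj : j ≤ l) : (twistMatrix q (truncCoeff F t) l).det.coeff j ≠ 0 := by
  induction l generalizing t with
  | zero =>
    obtain rfl : j = 0 := by omega
    simp
  | succ l ih =>
    rcases hj.eq_or_lt with rfl | hj
    · rw [twistMatrix_det_coeff_self]
      exact det_linearPart_ne_zero F hq _ _ ht
    · intro h0
      obtain ⟨e, rfl⟩ : ∃ e, q = e + 1 := ⟨q - 1, by omega⟩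
      rw [Nat.add_sub_cancel] at ht ih
      have h1 := congrArg (truncate F ((l + 1) * e)) h0
      have h2 : (twistMatrix (e + 1) (truncCoeff F ((l + 1) * e)) (l + 1)).det
          = (twistMatrix (e + 1) (truncCoeff F t) (l + 1)).det.map
            (truncate F ((l + 1) * e)).toRingHom := by
        rw [← Polynomial.coe_mapRingHom, RingHom.map_det, twistMatrix_map]
        congr 2
        ext1 s
        exact (truncate_truncCoeff F ht.le s).symm
      have h3 : (twistMatrix (e + 1) (truncCoeff F ((l + 1) * e)) (l + 1)).det.coeff j = 0 := by
        rw [h2, Polynomial.coeff_map]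
        exact h1.trans (map_zero _)
      have hpos : 1 ≤ (l + 1) * e := Nat.mul_pos (by omega) (by omega)
      have hidx : ((l : ℤ) + 1) * (((e + 1 : ℕ) : ℤ) - 1) - 1 = (((l + 1) * e - 1 : ℕ) : ℤ) := by
        rw [Nat.cast_sub hpos]; push_cast; ring
      rw [twistMatrix_det_succ fun s hs => truncCoeff_eq_zero F (by push_cast at hs ⊢; linarith),
        hidx, truncCoeff_natCast F (by omega), ← map_neg, Polynomial.coeff_C_mul] at h3
      rcases mul_eq_zero.1 h3 with h4 | h4
      · exact X_ne_zero _ (neg_eq_zero.1 h4)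
      · exact ih _ (by nlinarith) (by omega) h4

/-- The coefficient of `T ^ j` in the `n`-th coefficient of the characteristic polynomial does not
vanish identically if `j < n` and `n (q - 1) ≤ m + 1`. -/
lemma twistMatrix_charpoly_coeff_ne_zero {q : ℕ} (hq : 2 ≤ q) {m k n j : ℕ} (hn : n ≤ k)
    (hnm : n * (q - 1) ≤ m + 1) (hj : j < n) :
    ((twistMatrix q (genericCoeff F m) k).charpoly.coeff (k - n)).coeff j ≠ 0 := by
  intro h0
  obtain ⟨l, rfl⟩ : ∃ l, n = l + 1 := ⟨n - 1, by omega⟩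
  obtain ⟨e, rfl⟩ : ∃ e, q = e + 1 := ⟨q - 1, by omega⟩
  rw [Nat.add_sub_cancel] at hnm
  -- specialize to polynomials of degree less than `n (q - 1)`
  have h2 := twistMatrix_charpoly_coeff_map
    (truncateFin F m ((l + 1) * e) : MvPolynomial (Fin (m + 1)) F →+* MvPolynomial ℕ F) (e + 1)
    (genericCoeff F m) k (k - (l + 1))
  have h3 : ((twistMatrix (e + 1) (truncCoeff F ((l + 1) * e)) k).charpoly.coeff
      (k - (l + 1))).coeff j = 0 := by
    simp only [RingHom.coe_coe, truncateFin_genericCoeff F hnm] at h2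
    rw [← h2, Polynomial.coeff_map, h0, map_zero]
  have hvan : ∀ s : ℤ, (l + 1) * (((e + 1 : ℕ) : ℤ) - 1) ≤ s →
      truncCoeff F ((l + 1) * e) s = 0 := fun s hs =>
    truncCoeff_eq_zero F (by push_cast at hs ⊢; linarith)
  have hpos : 1 ≤ (l + 1) * e := Nat.mul_pos (by omega) (by omega)
  have hidx : ((l : ℤ) + 1) * (((e + 1 : ℕ) : ℤ) - 1) - 1 = (((l + 1) * e - 1 : ℕ) : ℤ) := by
    rw [Nat.cast_sub hpos]; push_cast; ring
  have h4 := Polynomial.coeff_X_pow_mul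
    (twistMatrix (e + 1) (truncCoeff F ((l + 1) * e)) (l + 1)).charpoly (k - (l + 1)) 0
  rw [zero_add] at h4
  have he : (1 : ℤ) ≤ e := by exact_mod_cast Nat.le_of_succ_le_succ hq
  rw [twistMatrix_charpoly_stable hq hn fun s hs => hvan s (by push_cast at hs ⊢; linarith), h4,
    twistMatrix_charpoly_succ hvan, Polynomial.mul_coeff_zero, Polynomial.coeff_add,
    Polynomial.coeff_X_zero, zero_add, Polynomial.coeff_C_zero, Polynomial.coeff_C_mul, hidx,
    truncCoeff_natCast F (by omega)] at h3
  have h5 : (twistMatrix (e + 1) (truncCoeff F ((l + 1) * e)) l).det.coeff j = 0 := by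
    rw [Matrix.det_eq_sign_charpoly_coeff, ← map_one Polynomial.C, ← map_neg, ← map_pow,
      Polynomial.coeff_C_mul, (mul_eq_zero.1 h3).resolve_left (X_ne_zero _), mul_zero]
  exact twistMatrix_det_coeff_ne_zero F hq l _ j (by rw [Nat.add_sub_cancel]; nlinarith)
    (by omega) h5

end Nonvanishing

/-! ### The equations of the locus of analytic rank at least `r` -/

section Equations

lemma coeff_comp_X_add_one {R : Type*} [CommRing R] {p : Polynomial R} {k : ℕ}
    (hp : p.natDegree ≤ k) (i : ℕ) :
    (p.comp (Polynomial.X + 1)).coeff i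
      = ∑ n ∈ Finset.range (k + 1), ((k - n).choose i : R) * p.coeff (k - n) := by
  conv_lhs => rw [Polynomial.as_sum_range_C_mul_X_pow' p (Nat.lt_succ_of_le hp)]
  have h := Finset.sum_range_reflect (fun n => (n.choose i : R) * p.coeff n) (k + 1)
  simp only [Nat.add_sub_cancel] at h
  rw [h]
  rw [← Polynomial.coe_compRingHom_apply, map_sum, Polynomial.finsetSum_coeff]
  refine Finset.sum_congr rfl fun n _ => ?_
  rw [Polynomial.coe_compRingHom_apply, Polynomial.mul_comp, Polynomial.C_comp,
    Polynomial.X_pow_comp, Polynomial.coeff_C_mul, Polynomial.coeff_X_add_one_pow, mul_comm]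

variable (F : Type*) [Field F] [Fintype F]

lemma two_le_card : 2 ≤ Fintype.card F := Fintype.one_lt_card

/-- The coefficient of `T ^ j` in the `n`-th coefficient of the characteristic polynomial of the
generic matrix of size `k`; it is a form of degree `n` in `a_0, …, a_m` if `n ≤ k`. -/
def charCoeff (m k n j : ℕ) : MvPolynomial (Fin (m + 1)) F :=
  ((twistMatrix (Fintype.card F) (genericCoeff F m) k).charpoly.coeff (k - n)).coeff j

lemma isForm_genericCoeff (m : ℕ) {k n : ℕ} (hn : n ≤ k) :
    IsForm n ((twistMatrix (Fintype.card F) (genericCoeff F m) k).charpoly.coeff (k - n)) :=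
  isForm_charpoly_coeff _ (isForm_twistMatrix (genericCoeff_isHomogeneous F m)) hn

variable {F} in
lemma charCoeff_zero (m k j : ℕ) : charCoeff F m k 0 j = if j = 0 then 1 else 0 := by
  have h := (Matrix.charpoly_monic
    (twistMatrix (Fintype.card F) (genericCoeff F m) k)).coeff_natDegree
  rw [Matrix.charpoly_natDegree_eq_dim, Fintype.card_fin] at h
  rw [charCoeff, Nat.sub_zero, h, Polynomial.coeff_one]

lemma charCoeff_ne_zero {m k n j : ℕ} (hn : n ≤ k) (hnm : n * (Fintype.card F - 1) ≤ m + 1)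
    (hj : j < n) : charCoeff F m k n j ≠ 0 :=
  twistMatrix_charpoly_coeff_ne_zero F (two_le_card F) hn hnm hj

lemma charCoeff_eq_zero {m k l n j : ℕ} (hl : m + 2 ≤ (l + 1) * (Fintype.card F - 1))
    (hln : l < n) (hn : n ≤ k) : charCoeff F m k n j = 0 := by
  have hq := two_le_card F
  have hl' : (m : ℤ) + 2 ≤ (l + 1) * ((Fintype.card F : ℤ) - 1) := by
    have : (((Fintype.card F - 1 : ℕ)) : ℤ) = (Fintype.card F : ℤ) - 1 := by
      push_cast [Nat.cast_sub (by omega : 1 ≤ Fintype.card F)]; ring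
    rw [← this]; exact_mod_cast hl
  rw [charCoeff, twistMatrix_charpoly_stable hq (by omega : l ≤ k)
    fun s hs => genericCoeff_eq_zero F (by linarith), Polynomial.coeff_X_pow_mul',
    if_neg (by omega), Polynomial.coeff_zero]

lemma d_eq_sum (m k i j : ℕ) :
    d F m k i j = ∑ n ∈ Finset.range (k + 1), C ((k - n).choose i : F) * charCoeff F m k n j := by
  rw [d, D, coeff_comp_X_add_one (k := k), frobMatrix_eq_twistMatrix, Polynomial.finsetSum_coeff]
  · refine Finset.sum_congr rfl fun n _ => ?_
    rw [charCoeff, Polynomial.natCast_mul, Polynomial.coeff_smul, nsmul_eq_mul, map_natCast]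
  · rw [Matrix.charpoly_natDegree_eq_dim, Fintype.card_fin]

lemma isHomogeneous_summand (m i j : ℕ) {k n : ℕ} (hn : n ≤ k) :
    (C ((k - n).choose i : F) * charCoeff F m k n j).IsHomogeneous n := by
  have h := (isHomogeneous_C _ ((k - n).choose i : F)).mul ((isForm_genericCoeff F m hn).2 j)
  rwa [zero_add] at h

lemma homogeneousComponent_d (m i j : ℕ) {k n : ℕ} (hn : n ≤ k) :
    homogeneousComponent n (d F m k i j) = C ((k - n).choose i : F) * charCoeff F m k n j := by
  rw [d_eq_sum, map_sum, Finset.sum_eq_single n]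
  · rw [homogeneousComponent_of_mem (isHomogeneous_summand F m i j hn), if_pos rfl]
  · intro b hb hbn
    rw [homogeneousComponent_of_mem (isHomogeneous_summand F m i j
      (Nat.le_of_lt_succ (Finset.mem_range.1 hb))), if_neg hbn.symm]
  · intro h
    exact absurd (Finset.mem_range.2 (Nat.lt_succ_of_le hn)) h

lemma totalDegree_d_le (m k i j : ℕ) : (d F m k i j).totalDegree ≤ k := by
  rw [d_eq_sum]
  refine totalDegree_finsetSum_le fun n hn => ?_
  have hn' := Nat.le_of_lt_succ (Finset.mem_range.1 hn)
  exact (isHomogeneous_summand F m i j hn').totalDegree_le.trans hn'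

lemma d_ne_zero {m k n i j : ℕ} (hn : n ≤ k) (hnm : n * (Fintype.card F - 1) ≤ m + 1)
    (hj : j < n) (hc : ((k - n).choose i : F) ≠ 0) : d F m k i j ≠ 0 := by
  intro h
  have h1 := homogeneousComponent_d F m i j hn
  rw [h, map_zero] at h1
  exact mul_ne_zero ((map_ne_zero_iff _ (C_injective _ _)).2 hc)
    (charCoeff_ne_zero F hn hnm hj) h1.symm

end Equations

/-! ### Counting the nonzero equations -/

section Counting

open Classical in
/-- The largest `n ≤ l` for which `binom (k - n) i` is nonzero in `F` (and `0` if there is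
none). -/
def topIndex (F : Type*) [Field F] (k l i : ℕ) : ℕ :=
  Nat.findGreatest (fun n => ((k - n).choose i : F) ≠ 0) l

variable {F : Type*} [Field F]

lemma topIndex_le (k l i : ℕ) : topIndex F k l i ≤ l := by
  classical
  exact Nat.findGreatest_le _

lemma le_topIndex {k l i n : ℕ} (hn : n ≤ l) (h : ((k - n).choose i : F) ≠ 0) :
    n ≤ topIndex F k l i := by
  classical
  exact Nat.le_findGreatest hn h

lemma topIndex_spec {k l i n : ℕ} (hn : n ≤ l) (h : ((k - n).choose i : F) ≠ 0) :
    ((k - topIndex F k l i).choose i : F) ≠ 0 := by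
  classical
  exact Nat.findGreatest_spec (P := fun n => ((k - n).choose i : F) ≠ 0) hn h

lemma choose_pascal {k n : ℕ} (hn : n < k) (i : ℕ) :
    ((k - n).choose (i + 1) : F)
      = ((k - (n + 1)).choose i : F) + ((k - (n + 1)).choose (i + 1) : F) := by
  obtain ⟨t, ht⟩ : ∃ t, k - n = t + 1 := ⟨k - n - 1, by omega⟩
  rw [ht, (by omega : k - (n + 1) = t), Nat.choose_succ_succ]
  push_cast
  ring

lemma topIndex_zero (k l : ℕ) : topIndex F k l 0 = l :=
  (topIndex_le k l 0).antisymm (le_topIndex le_rfl (by simp))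

/-- As a function of `i`, the top index is a sawtooth: it descends by steps of one, except for
jumps up to the maximal value `l`. -/
lemma topIndex_succ {k l i n : ℕ} (hl : l ≤ k) (hn : n ≤ l)
    (h : ((k - n).choose (i + 1) : F) ≠ 0) :
    topIndex F k l (i + 1) = l ∨ topIndex F k l i = topIndex F k l (i + 1) + 1 := by
  set u := topIndex F k l (i + 1) with hu
  rcases (topIndex_le (F := F) k l (i + 1)).eq_or_lt with h1 | h1
  · exact Or.inl h1
  rw [← hu] at h1
  have hzero : ∀ b, u < b → b ≤ l → ((k - b).choose (i + 1) : F) = 0 := fun b hb hbl =>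
    by_contra fun hne => absurd (le_topIndex hbl hne) (by omega)
  have hspec : ((k - u).choose (i + 1) : F) ≠ 0 := topIndex_spec hn h
  have h2 : ((k - (u + 1)).choose i : F) ≠ 0 := by
    rw [choose_pascal (by omega), hzero (u + 1) (by omega) (by omega), add_zero] at hspec
    exact hspec
  refine Or.inr (le_antisymm ?_ (le_topIndex h1 h2))
  by_contra! hgt
  obtain ⟨b, hb⟩ : ∃ b, topIndex F k l i = b + 1 := ⟨topIndex F k l i - 1, by omega⟩
  have hbl : b + 1 ≤ l := hb ▸ topIndex_le k l i
  have h3 := topIndex_spec h1 h2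
  have h4 := choose_pascal (F := F) (by omega : b < k) i
  rw [hzero b (by omega) (by omega), hzero (b + 1) (by omega) hbl, add_zero, ← hb] at h4
  exact h3 h4.symm

/-- The average of a sawtooth function with values in `[1, l]` that starts at `l`, descends by steps
of one and jumps only up to `l` is at least `(l + 1) / 2`. -/
lemma sawtooth_sum {l r : ℕ} {ν : ℕ → ℕ} (h0 : ν 0 = l) (hpos : ∀ i < r, 1 ≤ ν i)
    (hle : ∀ i, ν i ≤ l)
    (hstep : ∀ i, i + 1 < r → ν (i + 1) = l ∨ ν i = ν (i + 1) + 1) :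
    r * (l + 1) ≤ 2 * ∑ i ∈ Finset.range r, ν i := by
  -- an excess term depending on the last value makes the induction work
  have key : ∀ i < r, ((i : ℤ) + 1) * (l + 1) + (l + 1 - ν i) * (ν i - 1)
      ≤ 2 * ∑ b ∈ Finset.range (i + 1), (ν b : ℤ) := by
    intro i hi
    induction i with
    | zero => simp [h0]; linarith
    | succ i ih =>
      have ih := ih (by omega)
      rw [Finset.sum_range_succ]
      have h1 : (1 : ℤ) ≤ ν i := by exact_mod_cast hpos i (by omega)
      have h2 : (ν i : ℤ) ≤ l := by exact_mod_cast hle i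
      rcases hstep i hi with h | h
      · rw [h]; push_cast; nlinarith [mul_nonneg (by linarith : (0 : ℤ) ≤ l + 1 - ν i)
          (by linarith : (0 : ℤ) ≤ ν i - 1)]
      · rw [h] at ih; push_cast at ih ⊢; nlinarith
  rcases r with _ | r
  · simp
  have h := key r (by omega)
  have h1 : (1 : ℤ) ≤ ν r := by exact_mod_cast hpos r (by omega)
  have h2 : (ν r : ℤ) ≤ l := by exact_mod_cast hle r
  have h3 := mul_nonneg (by linarith : (0 : ℤ) ≤ l + 1 - ν r) (by linarith : (0 : ℤ) ≤ ν r - 1)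
  zify
  linarith

/-- If no `i < r` has `binom k i` as its only nonzero value among the `binom (k - n) i`, `n ≤ l`,
then each `i < r` has a nonzero one with `n ≥ 1`. -/
lemma exists_choose_ne_zero {k l r : ℕ} (hl : l ≤ k)
    (h : ∀ i < r, (k.choose i : F) ≠ 0 → ∃ n, 1 ≤ n ∧ n ≤ l ∧ ((k - n).choose i : F) ≠ 0) :
    ∀ i < r, ∃ n, 1 ≤ n ∧ n ≤ l ∧ ((k - n).choose i : F) ≠ 0 := by
  intro i hi
  induction i with
  | zero => exact h 0 hi (by simp)
  | succ i ih =>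
    by_contra! hcon
    have h0 : (k.choose (i + 1) : F) = 0 := by
      by_contra hne
      obtain ⟨n, h1, h2, h3⟩ := h _ hi hne
      exact h3 (hcon n h1 h2)
    obtain ⟨n, h1, h2, h3⟩ := ih (by omega)
    obtain ⟨b, rfl⟩ : ∃ b, n = b + 1 := ⟨n - 1, by omega⟩
    have h4 := choose_pascal (F := F) (by omega : b < k) i
    rw [hcon (b + 1) h1 h2, add_zero] at h4
    refine h3 (h4.symm.trans ?_)
    rcases Nat.eq_zero_or_pos b with rfl | hb
    · simpa using h0
    · exact hcon b hb (by omega)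

open Classical in
/-- Row `i` of the system contains at least `topIndex i` nonzero equations. -/
lemma sum_topIndex_le_card [Fintype F] {m k l r : ℕ} (hl : l ≤ k)
    (hlm : l * (Fintype.card F - 1) ≤ m + 1)
    (h : ∀ i < r, ∃ n, 1 ≤ n ∧ n ≤ l ∧ ((k - n).choose i : F) ≠ 0) :
    ∑ i ∈ Finset.range r, topIndex F k l i
      ≤ ((eqIndex k r).filter fun t => dbar F m k t ≠ 0).card := by
  have hcard : ∑ i ∈ Finset.range r, topIndex F k l i
      = ((Finset.range r).sigma fun i => Finset.range (topIndex F k l i)).card := by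
    simp
  rw [hcard]
  refine Finset.card_le_card_of_injOn (fun x => (x.1, x.2)) ?_ ?_
  · rintro ⟨i, j⟩ hij
    simp only [Finset.coe_sigma, Set.mem_sigma_iff, Finset.coe_range, Set.mem_Iio] at hij
    obtain ⟨n, h1, h2, h3⟩ := h i hij.1
    have h4 := topIndex_spec h2 h3
    have h5 := topIndex_le (F := F) k l i
    have h6 : i ≤ k - topIndex F k l i := by
      by_contra! hlt
      exact h4 (by rw [Nat.choose_eq_zero_of_lt hlt, Nat.cast_zero])
    have h7 : d F m k i j ≠ 0 :=
      d_ne_zero F (h5.trans hl) ((Nat.mul_le_mul_right _ h5).trans hlm) hij.2 h4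
    simp only [eqIndex, Finset.coe_filter, Finset.mem_filter, Finset.mem_product,
      Finset.mem_range, Set.mem_ofPred_eq]
    exact ⟨⟨⟨hij.1, by omega⟩, by omega⟩, homogenize_ne_zero h7⟩
  · rintro ⟨i, j⟩ _ ⟨i', j'⟩ _ hij
    simpa using hij

end Counting

/-! ### Emptiness of the complete intersections of large rank -/

section Emptiness

variable {F : Type*} [Field F] [Fintype F]

/-- If the locus is not empty, then none of its equations `d_{i0}` is a nonzero constant. -/
lemma exists_choose_ne_zero_of_Rbar_nonempty {m k l r : ℕ}
    (hlm : m + 2 ≤ (l + 1) * (Fintype.card F - 1)) (hne : (Rbar F m k r).Nonempty) :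
    ∀ i < r, (k.choose i : F) ≠ 0 → ∃ n, 1 ≤ n ∧ n ≤ l ∧ ((k - n).choose i : F) ≠ 0 := by
  intro i hi hki
  by_contra! hcon
  have hik : i ≤ k := by
    by_contra! hlt
    exact hki (by rw [Nat.choose_eq_zero_of_lt hlt, Nat.cast_zero])
  have hd : d F m k i 0 = C (k.choose i : F) := by
    rw [d_eq_sum, Finset.sum_eq_single 0]
    · simp [charCoeff_zero]
    · intro n hn h0
      have hnk := Nat.le_of_lt_succ (Finset.mem_range.1 hn)
      rcases le_or_gt n l with h | h
      · rw [hcon n (by omega) h, map_zero, zero_mul]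
      · rw [charCoeff_eq_zero F hlm h hnk, mul_zero]
    · simp
  obtain ⟨x, hx⟩ := hne
  have h1 := hx (i, 0) (by simp [eqIndex, hi, hik]) 0 (Submodule.zero_mem _)
  simp only [dbar, hd, homogenize_C, aeval_C] at h1
  exact hki ((map_eq_zero _).1 h1)

theorem Rbar_eq_empty {m k r : ℕ} (hr : 2 * Fintype.card F < r + 3)
    (hk : m + 1 ≤ k * (Fintype.card F - 1))
    (hci : IsCompleteIntersection (AlgebraicClosure F) (eqIndex k r) (dbar F m k)) :
    Rbar F m k r = ∅ := by
  classical
  by_contra hempty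
  have hne : (Rbar F m k r).Nonempty := Set.nonempty_iff_ne_empty.2 hempty
  have hq := two_le_card F
  obtain ⟨e, he⟩ : ∃ e, Fintype.card F = e + 1 := ⟨Fintype.card F - 1, by omega⟩
  have he' : Fintype.card F - 1 = e := by omega
  obtain ⟨l, hl⟩ : ∃ l, l = (m + 1) / e := ⟨_, rfl⟩
  have hl1 : l * e ≤ m + 1 := hl ▸ Nat.div_mul_le_self _ _
  have hl2 : m + 2 ≤ (l + 1) * e := by
    rw [hl, mul_comm]; exact Nat.lt_mul_div_succ _ (by omega)
  have hlk : l ≤ k := by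
    rw [he'] at hk
    exact Nat.le_of_mul_le_mul_right (hl1.trans hk) (by omega)
  have hex := exists_choose_ne_zero hlk
    (exists_choose_ne_zero_of_Rbar_nonempty (by rwa [he']) hne)
  have hcount := sum_topIndex_le_card (m := m) hlk (by rwa [he']) hex
  have hlt := hcount.trans_lt (lt_of_eq_of_lt (by congr!) (hci.card_lt hne))
  rw [Fintype.card_option, Fintype.card_fin] at hlt
  have hsaw := sawtooth_sum (ν := topIndex F k l) (l := l) (r := r) (topIndex_zero k l)
    (fun i hi => by
      obtain ⟨n, h1, h2, h3⟩ := hex i hi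
      exact h1.trans (le_topIndex h2 h3))
    (topIndex_le k l)
    (fun i hi => by
      obtain ⟨n, h1, h2, h3⟩ := hex (i + 1) hi
      exact topIndex_succ hlk h2 h3)
  have h5 : 2 * e * (l + 1) ≤ r * (l + 1) := Nat.mul_le_mul_right _ (by omega)
  have h6 : 2 * e * (l + 1) = 2 * ((l + 1) * e) := by ring
  omega

end Emptiness

/-! ### Nonemptiness for small rank -/

section Nonemptiness

lemma coeff_X_pow_mul_X_sub_C_pow {R : Type*} [CommRing R] (y : R) {k l n : ℕ} (hl : l ≤ k)
    (hn : n ≤ k) :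
    ((Polynomial.X ^ (k - l) * (Polynomial.X - Polynomial.C y) ^ l : Polynomial R)).coeff (k - n)
      = (-y) ^ n * (l.choose n : R) := by
  rw [Polynomial.coeff_X_pow_mul']
  split_ifs with h
  · have hnl : n ≤ l := by omega
    rw [sub_eq_add_neg, ← Polynomial.C_neg, Polynomial.coeff_X_add_C_pow,
      (by omega : k - n - (k - l) = l - n), Nat.choose_symm hnl,
      (by omega : l - (l - n) = n)]
  · rw [Nat.choose_eq_zero_of_lt (by omega), Nat.cast_zero, mul_zero]

/-- The coefficient of `W ^ i`, `i < l`, in `(W + 1) ^ (k - l) * W ^ l`. -/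
lemma sum_choose_mul_choose_eq_zero (R : Type*) [CommRing R] {k l i : ℕ} (hl : l ≤ k)
    (hi : i < l) :
    ∑ n ∈ Finset.range (k + 1), ((k - n).choose i : R) * ((-1) ^ n * (l.choose n : R)) = 0 := by
  have hdeg : (Polynomial.X ^ (k - l) * (Polynomial.X - Polynomial.C 1) ^ l :
      Polynomial R).natDegree ≤ k := by
    refine Polynomial.natDegree_mul_le_of_le (m := k - l) (n := l)
      (Polynomial.natDegree_X_pow_le _) ?_ |>.trans (by omega)
    exact (Polynomial.natDegree_pow_le_of_le l (Polynomial.natDegree_X_sub_C_le 1)).trans (by simp)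
  have h := coeff_comp_X_add_one hdeg i
  have h2 : ((Polynomial.X ^ (k - l) * (Polynomial.X - Polynomial.C 1) ^ l :
      Polynomial R).comp (Polynomial.X + 1)).coeff i = 0 := by
    simp only [Polynomial.mul_comp, Polynomial.pow_comp, Polynomial.sub_comp, Polynomial.X_comp,
      map_one, Polynomial.one_comp, add_sub_cancel_right]
    rw [Polynomial.coeff_mul_X_pow', if_neg (by omega)]
  rw [← h2, h]
  refine Finset.sum_congr rfl fun n hn => ?_
  rw [coeff_X_pow_mul_X_sub_C_pow 1 hl (Nat.le_of_lt_succ (Finset.mem_range.1 hn))]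

variable (F : Type*) [Field F] [Fintype F]

/-- The specialization of the coefficients of the characteristic polynomial at a point. -/
lemma aeval_charCoeff {K : Type*} [Field K] [Algebra F K] (m k n j : ℕ) (a : Fin (m + 1) → K) :
    aeval a (charCoeff F m k n j) = ((twistMatrix (Fintype.card F)
      (fun s => aeval a (genericCoeff F m s)) k).charpoly.coeff (k - n)).coeff j := by
  have h := twistMatrix_charpoly_coeff_map
    (aeval a : MvPolynomial (Fin (m + 1)) F →ₐ[F] K).toRingHom (Fintype.card F)
    (genericCoeff F m) k (k - n)
  have h2 := congrArg (fun p => Polynomial.coeff p j) h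
  simp only [Polynomial.coeff_map] at h2
  exact h2

/-- The equations expressing that the characteristic polynomial of `𝔐(P, l - 1)` is
`(V - x₀) ^ (l - 1)` (those with `n ≥ 1`) and that the leading coefficient of `P` is `-x₀` (the one
with `n = 0`). -/
def unipotentEq (K : Type*) [Field K] [Algebra F K] (m l : ℕ) (t : Σ n : Fin l, Fin (n + 1)) :
    MvPolynomial (Option (Fin (m + 1))) K :=
  if (t.1 : ℕ) = 0 then X (some (Fin.last m)) + X none
  else rename some (map (algebraMap F K) (charCoeff F m (l - 1) t.1 t.2))
    - (if (t.2 : ℕ) = 0 then C ((l - 1).choose t.1 : K) * (-X none) ^ (t.1 : ℕ) else 0)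

lemma unipotentEq_isHomogeneous (K : Type*) [Field K] [Algebra F K] (m l : ℕ)
    (t : Σ n : Fin l, Fin (n + 1)) : (unipotentEq F K m l t).IsHomogeneous (max 1 t.1) := by
  unfold unipotentEq
  split_ifs with h1 h2
  · rw [h1]; exact (isHomogeneous_X _ _).add (isHomogeneous_X _ _)
  all_goals rw [max_eq_right (by omega)]
  all_goals refine IsHomogeneous.sub (IsHomogeneous.rename_isHomogeneous
    (((isForm_genericCoeff F m (by omega)).2 _).map _)) ?_
  · have := (isHomogeneous_C (Option (Fin (m + 1))) ((l - 1).choose t.1 : K)).mul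
      (((isHomogeneous_X K (none : Option (Fin (m + 1)))).neg).pow t.1)
    simpa only [zero_add, one_mul] using this
  · exact isHomogeneous_zero _ _ _

lemma card_sigma_fin (l : ℕ) : 2 * Fintype.card (Σ n : Fin l, Fin (n + 1)) = l * (l + 1) := by
  rw [Fintype.card_sigma]
  simp only [Fintype.card_fin]
  rw [Fin.sum_univ_eq_sum_range (fun n => n + 1) l]
  induction l with
  | zero => simp
  | succ l ih => rw [Finset.sum_range_succ, mul_add, ih]; ring

variable {F} {K : Type*} [Field K] [Algebra F K]

/-- At a solution, all the matrices of size `k ≥ l` have characteristic polynomial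
`V ^ (k - l) * (V - x₀) ^ l`. -/
lemma charpoly_of_unipotentEq {m k l : ℕ} (hlm : m + 1 = l * (Fintype.card F - 1)) (hlk : l ≤ k)
    {v : Option (Fin (m + 1)) → K} (hv : ∀ t, aeval v (unipotentEq F K m l t) = 0) :
    (twistMatrix (Fintype.card F)
        (fun s => aeval (fun i => v (some i)) (genericCoeff F m s)) k).charpoly
      = Polynomial.X ^ (k - l) * (Polynomial.X - Polynomial.C (Polynomial.C (v none))) ^ l := by
  have hq := two_le_card F
  obtain ⟨l, rfl⟩ : ∃ b, l = b + 1 := ⟨l - 1, by rcases l with _ | l <;> omega⟩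
  set a : Fin (m + 1) → K := fun i => v (some i) with ha
  set α : ℤ → K := fun s => aeval a (genericCoeff F m s) with hα
  have hlm' : (m : ℤ) + 1 = (l + 1) * ((Fintype.card F : ℤ) - 1) := by
    have : (((Fintype.card F - 1 : ℕ)) : ℤ) = (Fintype.card F : ℤ) - 1 := by
      push_cast [Nat.cast_sub (by omega : 1 ≤ Fintype.card F)]; ring
    rw [← this]; exact_mod_cast hlm
  have hvan : ∀ s : ℤ, (m : ℤ) + 1 ≤ s → α s = 0 := fun s hs => by
    simp only [hα, genericCoeff_eq_zero F hs, map_zero]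
  have hlast : α m = -v none := by
    have h1 := hv ⟨0, 0⟩
    have h2 : genericCoeff F m m = X (Fin.last m) := by
      rw [genericCoeff, dif_pos (by omega)]
      rfl
    simp only [unipotentEq, Fin.val_zero, if_true, map_add, aeval_X] at h1
    simp only [hα, h2, aeval_X, ha]
    exact eq_neg_of_add_eq_zero_left h1
  have hsmall : (twistMatrix (Fintype.card F) α l).charpoly
      = (Polynomial.X - Polynomial.C (Polynomial.C (v none))) ^ l := by
    have hrhs := fun n (hn : n ≤ l) =>
      coeff_X_pow_mul_X_sub_C_pow (Polynomial.C (v none)) (le_refl l) hn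
    simp only [Nat.sub_self, pow_zero, one_mul] at hrhs
    ext N j
    rcases lt_or_ge l N with hN | hN
    · refine congrArg (Polynomial.coeff · j) ?_
      rw [Polynomial.coeff_eq_zero_of_natDegree_lt, Polynomial.coeff_eq_zero_of_natDegree_lt]
      · rw [Polynomial.natDegree_pow, Polynomial.natDegree_X_sub_C]; simpa using hN
      · rw [Matrix.charpoly_natDegree_eq_dim, Fintype.card_fin]; exact hN
    obtain ⟨n, hn, rfl⟩ : ∃ n, n ≤ l ∧ N = l - n := ⟨l - N, by omega, by omega⟩
    rw [hrhs n hn, ← map_neg, ← map_pow, ← map_natCast Polynomial.C, ← map_mul,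
      Polynomial.coeff_C, ← aeval_charCoeff]
    rcases Nat.eq_zero_or_pos n with rfl | hn0
    · rw [charCoeff_zero]; split_ifs <;> simp
    rcases lt_or_ge n j with hj | hj
    · rw [charCoeff, Polynomial.coeff_eq_zero_of_natDegree_lt
        ((isForm_genericCoeff F m hn).1.trans_lt hj), map_zero, if_neg (by omega)]
    · have h1 := hv ⟨⟨n, by omega⟩, ⟨j, by simp; omega⟩⟩
      simp only [unipotentEq, if_neg hn0.ne', map_sub, aeval_rename, aeval_map_algebraMap,
        Nat.add_sub_cancel] at h1
      rw [sub_eq_zero] at h1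
      refine h1.trans ?_
      split_ifs
      · simp [mul_comm]
      · simp
  have hmid : (twistMatrix (Fintype.card F) α (l + 1)).charpoly
      = (Polynomial.X - Polynomial.C (Polynomial.C (v none))) ^ (l + 1) := by
    rw [twistMatrix_charpoly_succ fun s hs => hvan s (by linarith), hsmall, pow_succ',
      (by linarith : ((l : ℤ) + 1) * ((Fintype.card F : ℤ) - 1) - 1 = m), hlast, map_neg, map_neg,
      sub_eq_add_neg]
  rw [twistMatrix_charpoly_stable hq hlk fun s hs => hvan s ?_, hmid]
  have h3 : (2 : ℤ) ≤ Fintype.card F := by exact_mod_cast hq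
  push_cast at hs
  linarith

/-- Every solution is a zero of the equations of rank `l`, including the points at infinity. -/
lemma aeval_dbar_eq_zero {m k l i j : ℕ} (hlm : m + 1 = l * (Fintype.card F - 1)) (hlk : l ≤ k)
    (hi : i < l) {v : Option (Fin (m + 1)) → K} (hv : ∀ t, aeval v (unipotentEq F K m l t) = 0) :
    aeval v (dbar F m k (i, j)) = 0 := by
  have hD := totalDegree_d_le F m k i j
  set N := (d F m k i j).totalDegree with hN
  have hchar : ∀ n ≤ k, aeval (fun b => v (some b)) (charCoeff F m k n j)
      = if j = 0 then (-v none) ^ n * (l.choose n : K) else 0 := by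
    intro n hn
    rw [aeval_charCoeff, charpoly_of_unipotentEq hlm hlk hv, coeff_X_pow_mul_X_sub_C_pow _ hlk hn,
      ← map_neg, ← map_pow, ← map_natCast Polynomial.C, ← map_mul, Polynomial.coeff_C]
  have hterm : ∀ n ∈ Finset.range (N + 1), v none ^ (N - n)
      * aeval (fun b => v (some b)) (homogeneousComponent n (d F m k i j))
      = if j = 0 then v none ^ N * (((k - n).choose i : K) * ((-1) ^ n * (l.choose n : K)))
        else 0 := by
    intro n hn
    have hnN := Nat.le_of_lt_succ (Finset.mem_range.1 hn)
    have hnk := hnN.trans hD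
    rw [homogeneousComponent_d F m i j hnk, map_mul, hchar n hnk, aeval_C, map_natCast]
    split_ifs
    · rw [← Nat.sub_add_cancel hnN, pow_add, Nat.add_sub_cancel, neg_pow (v none)]
      ring
    · simp
  simp only [dbar]
  rw [aeval_homogenize, Finset.sum_congr rfl hterm]
  rcases Nat.eq_zero_or_pos j with rfl | hj
  · simp only [if_true]
    rw [← Finset.mul_sum]
    -- beyond the degree of the equation the summands vanish, because the forms do not
    have hsub : ∑ n ∈ Finset.range (N + 1), ((k - n).choose i : K) * ((-1) ^ n * (l.choose n : K))
        = ∑ n ∈ Finset.range (k + 1), ((k - n).choose i : K) * ((-1) ^ n * (l.choose n : K)) := by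
      refine Finset.sum_subset (Finset.range_mono (by omega)) fun n hn hn' => ?_
      have hnk := Nat.le_of_lt_succ (Finset.mem_range.1 hn)
      have hNn : N < n := by simpa using hn'
      rcases lt_or_ge l n with h | h
      · rw [Nat.choose_eq_zero_of_lt h]; simp
      · have h1 := homogeneousComponent_d F m i 0 hnk
        rw [homogeneousComponent_eq_zero _ _ hNn] at h1
        have h2 : charCoeff F m k n 0 ≠ 0 :=
          charCoeff_ne_zero F hnk ((Nat.mul_le_mul_right _ h).trans hlm.ge) (by omega)
        have h3 := (mul_eq_zero.1 h1.symm).resolve_right h2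
        rw [C_eq_zero] at h3
        have h4 := congrArg (algebraMap F K) h3
        rw [map_natCast, map_zero] at h4
        rw [h4, zero_mul]
    rw [hsub, sum_choose_mul_choose_eq_zero K hlk hi, mul_zero]
  · simp [hj.ne']

variable (F) in
theorem exists_Rbar_nonempty {r : ℕ} (hr : r + 3 ≤ 2 * Fintype.card F) :
    ∃ m : ℕ, ∀ k : ℕ, m + 1 ≤ k * (Fintype.card F - 1) → (Rbar F m k r).Nonempty := by
  have hq := two_le_card F
  obtain ⟨e, he⟩ : ∃ e, Fintype.card F = e + 2 := ⟨Fintype.card F - 2, by omega⟩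
  -- `l = 2 q - 3` is the value for which the number of equations is exactly `m + 1 = l (q - 1)`
  obtain ⟨m, hm⟩ : ∃ m, m + 1 = (2 * e + 1) * (Fintype.card F - 1) :=
    ⟨(2 * e + 1) * (Fintype.card F - 1) - 1,
      Nat.sub_add_cancel (Nat.mul_pos (by omega) (by omega))⟩
  refine ⟨m, fun k hk => ?_⟩
  have hlk : 2 * e + 1 ≤ k := Nat.le_of_mul_le_mul_right (hm ▸ hk) (by omega)
  have hcard : Fintype.card (Σ n : Fin (2 * e + 1), Fin (n + 1))
      < Fintype.card (Option (Fin (m + 1))) := by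
    have h1 := card_sigma_fin (2 * e + 1)
    have h2 : (2 * e + 1) * (2 * e + 1 + 1) = 2 * ((2 * e + 1) * (e + 2 - 1)) := by
      rw [(by omega : e + 2 - 1 = e + 1)]; ring
    rw [Fintype.card_option, Fintype.card_fin]
    rw [he] at hm
    omega
  obtain ⟨v, hv0, hv⟩ := exists_ne_zero_forall_aeval_eq_zero hcard
    (unipotentEq F (AlgebraicClosure F) m (2 * e + 1)) (fun t => max 1 t.1) (fun t => by simp)
    (unipotentEq_isHomogeneous F (AlgebraicClosure F) m (2 * e + 1))
  refine ⟨Projectivization.mk _ v hv0, ?_⟩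
  rintro ⟨i, j⟩ ht w hw
  rw [Projectivization.submodule_mk, Submodule.mem_span_singleton] at hw
  obtain ⟨c, rfl⟩ := hw
  have hir : i < r := by
    simp only [eqIndex, Finset.mem_filter, Finset.mem_product, Finset.mem_range] at ht
    exact ht.1.1
  refine aeval_dbar_eq_zero hm hlk (by omega) fun t => ?_
  rw [aeval_smul_of_isHomogeneous (unipotentEq_isHomogeneous F (AlgebraicClosure F) m _ t), hv,
    mul_zero]

end Nonemptiness

end CarlitzTwist

end

theorem proposition6p6 (F : Type*) [Field F] [Fintype F] (r : ℕ) :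
    (r + 3 ≤ 2 * Fintype.card F →
      ∃ m : ℕ, ∀ k : ℕ, m + 1 ≤ k * (Fintype.card F - 1) →
        0 ≤ CarlitzTwist.zariskiDim (CarlitzTwist.Rbar F m k r)) ∧
    (2 * Fintype.card F < r + 3 →
      ∀ m k : ℕ, m + 1 ≤ k * (Fintype.card F - 1) →
        CarlitzTwist.IsCompleteIntersection (AlgebraicClosure F)
          (CarlitzTwist.eqIndex k r) (CarlitzTwist.dbar F m k) →
        CarlitzTwist.Rbar F m k r = ∅) := by
  refine ⟨fun hr => ?_, fun hr m k hk hci => CarlitzTwist.Rbar_eq_empty hr hk hci⟩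
  obtain ⟨m, hm⟩ := CarlitzTwist.exists_Rbar_nonempty F hr
  exact ⟨m, fun k hk => CarlitzTwist.zariskiDim_nonneg (hm k hk)⟩
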